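/- Let $|\phi|<1$, let $(\varepsilon_n)_{n\ge 0}$ be i.i.d. $\mathcal N(0,1)$ random variables, and let $X_n=\varepsilon_n+\phi\,\varepsilon_{n-1}$ for $n\ge 1$. For $\lambda=(\lambda_1,\lambda_2)\in\mathbb R^2$ put $$L_n(\lambda)=\frac1n\log\mathbb E\exp\Big(\lambda_1\sum_{k=1}^nX_k^2+\lambda_2\sum_{k=2}^nX_kX_{k-1}\Big)\in(-\infty,+\infty].$$ Let $r=1-2\lambda_1(1+\phi^2)-\lambda_2\phi$, $p=1-2\lambda_1(1+\phi^2)-2\lambda_2\phi$, $q=-2\lambda_1\phi-\lambda_2(1+\phi^2)$, $s=-\lambda_2\phi$. For $n\ge2$ let $D_{n,\lambda}$ be the symmetric $n\times n$ pentadiagonal matrix with diagonal $(r,p,\dots,p,r)$, all entries of the first off-diagonals equal to $q$, all entries of the second off-diagonals equal to $s$, and zeros elsewhere. Let $\mathcal D_\lambda=\mathcal D_\lambda^1\cup\mathcal D_\lambda^2$, where $$\mathcal D_\lambda^1=\Big\{\tfrac{1+4\lambda_2\phi}{2(1+\phi^2)}\le\lambda_1\le\tfrac1{2(1+\phi^2)},\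 (2\lambda_1\phi+\lambda_2(1+\phi^2))^2\le-4\lambda_2\phi\,(1-2\lambda_1(1+\phi^2))\Big\},$$ $$\mathcal D_\lambda^2=\Big\{\tfrac{-1+2\lambda_1(1+\phi^2)}4<\lambda_2\phi\le\tfrac{1-2\lambda_1(1+\phi^2)}4,\ \lambda_1-\tfrac1{2(1-\phi)^2}\le\lambda_2\le\tfrac1{2(1+\phi)^2}-\lambda_1\Big\},$$ and let $\mathcal D_\lambda^0$ be the set of all points $$\lambda_1=\frac{1+\phi^2+4\phi\cos\frac{k\pi}{n+1}}{2\big(1+\phi^2+2\phi\cos\frac{k\pi}{n+1}\big)^2},\qquad \lambda_2=\frac{-\phi}{\big(1+\phi^2+2\phi\cos\frac{k\pi}{n+1}\big)^2},\qquad 1\le k\le n,\ n\in\mathbb N,$$ with closure $\overline{\mathcal D_\lambda^0}$. Define $$\mathcal L(\lambda)=\begin{cases}-\dfrac12\log\left[\dfrac{(p-2s)(1+\sqrt{1-A^2})(1+\sqrt{1-B^2})}4\right],&\lambda\in\mathcal D_\lambda\setminus\overline{\mathcal D_\lambda^0},\\[2mm]+\infty,&\text{otherwise,}\end{cases}$$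 $$A=\frac{q-\sqrt{q^2-4s(p-2s)}}{p-2s},\qquad B=\frac{q+\sqrt{q^2-4s(p-2s)}}{p-2s},$$ with principal complex square roots. Then the following hold. 1. If $\lambda\in\mathcal D_\lambda\setminus\overline{\mathcal D_\lambda^0}$, then the argument of the logarithm is a positive real number, $D_{n,\lambda}$ is positive definite for every $n\ge2$, and $$\lim_{n\to\infty}L_n(\lambda)=\lim_{n\to\infty}-\frac1{2n}\log\det D_{n,\lambda}=\mathcal L(\lambda).$$ 2. If $\lambda\notin\mathcal D_\lambda$, then $\lim_{n\to\infty}L_n(\lambda)=+\infty=\mathcal L(\lambda)$. 3. If $\lambda\in\mathcal D_\lambda^0$, then $L_n(\lambda)=+\infty$ for infinitely many $n$. On $\overline{\mathcal D_\lambda^0}$ the value $\mathcal L=+\infty$ is a convention; no convergence of $L_n$ is asserted there. -/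

import Mathlib

open MeasureTheory ProbabilityTheory Filter Topology

noncomputable section

namespace MA1

/-- The moving average process `X_n = ε_n + φ ε_{n-1}`; only the indices `n ≥ 1` are used. -/
def X {Ω : Type*} (φ : ℝ) (ε : ℕ → Ω → ℝ) (n : ℕ) (ω : Ω) : ℝ :=
  ε n ω + φ * ε (n - 1) ω

/-- `U_n = ∑_{k=1}^n X_k²`. -/
def U {Ω : Type*} (φ : ℝ) (ε : ℕ → Ω → ℝ) (n : ℕ) (ω : Ω) : ℝ :=
  ∑ k ∈ Finset.Icc 1 n, X φ ε k ω ^ 2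

/-- `V_n = ∑_{k=2}^n X_k X_{k-1}`. -/
def V {Ω : Type*} (φ : ℝ) (ε : ℕ → Ω → ℝ) (n : ℕ) (ω : Ω) : ℝ :=
  ∑ k ∈ Finset.Icc 2 n, X φ ε k ω * X φ ε (k - 1) ω

/-- The normalized cumulant generating function
`L_n(λ) = (1/n) log 𝔼 exp(λ₁ U_n + λ₂ V_n)`, with values in `[-∞, +∞]`:
it is `+∞` exactly when the expectation is infinite. -/
def L {Ω : Type*} [MeasurableSpace Ω] (P : Measure Ω) (φ : ℝ) (ε : ℕ → Ω → ℝ)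
    (n : ℕ) (l : ℝ × ℝ) : EReal :=
  ((1 / (n : ℝ) : ℝ) : EReal) *
    ENNReal.log (∫⁻ ω, ENNReal.ofReal (Real.exp (l.1 * U φ ε n ω + l.2 * V φ ε n ω)) ∂P)

def r (φ : ℝ) (l : ℝ × ℝ) : ℝ := 1 - 2 * l.1 * (1 + φ ^ 2) - l.2 * φ

def p (φ : ℝ) (l : ℝ × ℝ) : ℝ := 1 - 2 * l.1 * (1 + φ ^ 2) - 2 * l.2 * φ

def q (φ : ℝ) (l : ℝ × ℝ) : ℝ := -2 * l.1 * φ - l.2 * (1 + φ ^ 2)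

def s (φ : ℝ) (l : ℝ × ℝ) : ℝ := -l.2 * φ

/-- The symmetric pentadiagonal matrix `D_{n,λ}` (meant for `n ≥ 2`): diagonal `r, p, …, p, r`,
first off-diagonals `q`, second off-diagonals `s`, zero elsewhere. -/
def D (φ : ℝ) (l : ℝ × ℝ) (n : ℕ) : Matrix (Fin n) (Fin n) ℝ :=
  Matrix.of fun i j =>
    if i = j then (if (i : ℕ) = 0 ∨ (i : ℕ) + 1 = n then r φ l else p φ l)
    else if (i : ℕ) + 1 = j ∨ (j : ℕ) + 1 = i then q φ l
    else if (i : ℕ) + 2 = j ∨ (j : ℕ) + 2 = i then s φ l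
    else 0

/-- The set `D_λ^1`. -/
def dom1 (φ : ℝ) : Set (ℝ × ℝ) :=
  {l | (1 + 4 * l.2 * φ) / (2 * (1 + φ ^ 2)) ≤ l.1 ∧ l.1 ≤ 1 / (2 * (1 + φ ^ 2)) ∧
    (2 * l.1 * φ + l.2 * (1 + φ ^ 2)) ^ 2 ≤ -4 * l.2 * φ * (1 - 2 * l.1 * (1 + φ ^ 2))}

/-- The set `D_λ^2`. -/
def dom2 (φ : ℝ) : Set (ℝ × ℝ) :=
  {l | (-1 + 2 * l.1 * (1 + φ ^ 2)) / 4 < l.2 * φ ∧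
    l.2 * φ ≤ (1 - 2 * l.1 * (1 + φ ^ 2)) / 4 ∧
    l.1 - 1 / (2 * (1 - φ) ^ 2) ≤ l.2 ∧ l.2 ≤ 1 / (2 * (1 + φ) ^ 2) - l.1}

/-- The domain `D_λ = D_λ^1 ∪ D_λ^2`. -/
def dom (φ : ℝ) : Set (ℝ × ℝ) := dom1 φ ∪ dom2 φ

/-- The set `D_λ^0`. -/
def dom0 (φ : ℝ) : Set (ℝ × ℝ) :=
  {l | ∃ n k : ℕ, 1 ≤ k ∧ k ≤ n ∧
    l.1 = (1 + φ ^ 2 + 4 * φ * Real.cos (k * Real.pi / (n + 1))) /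
      (2 * (1 + φ ^ 2 + 2 * φ * Real.cos (k * Real.pi / (n + 1))) ^ 2) ∧
    l.2 = -φ / (1 + φ ^ 2 + 2 * φ * Real.cos (k * Real.pi / (n + 1))) ^ 2}

/-- `√(q² - 4s(p - 2s))`; it may be imaginary. -/
def rootDisc (φ : ℝ) (l : ℝ × ℝ) : ℂ :=
  Complex.sqrt ((q φ l ^ 2 - 4 * s φ l * (p φ l - 2 * s φ l) : ℝ) : ℂ)

def A (φ : ℝ) (l : ℝ × ℝ) : ℂ :=
  ((q φ l : ℂ) - rootDisc φ l) / ((p φ l - 2 * s φ l : ℝ) : ℂ)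

def B (φ : ℝ) (l : ℝ × ℝ) : ℂ :=
  ((q φ l : ℂ) + rootDisc φ l) / ((p φ l - 2 * s φ l : ℝ) : ℂ)

/-- The argument `(p - 2s)(1 + √(1 - A²))(1 + √(1 - B²)) / 4` of the logarithm, computed in `ℂ`
with principal square roots. -/
def logArg (φ : ℝ) (l : ℝ × ℝ) : ℂ :=
  ((p φ l - 2 * s φ l : ℝ) : ℂ) * (1 + Complex.sqrt (1 - A φ l ^ 2)) *
    (1 + Complex.sqrt (1 - B φ l ^ 2)) / 4

open Classical in
/-- The limiting function: `-½ log[logArg]` on `D_λ` minus the closure of `D_λ^0`, and `+∞`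
otherwise. (On the first set `logArg` is a positive real; this is part of the theorem.) -/
def calL (φ : ℝ) (l : ℝ × ℝ) : EReal :=
  if l ∈ dom φ \ closure (dom0 φ) then ((-(1 / 2) * Real.log (logArg φ l).re : ℝ) : EReal) else ⊤

end MA1

end

/-!
Let `J` be the adjacency matrix of the path on `n` vertices. The covariance matrix of
`(X_1, …, X_n)` is `(1 + φ²) I + φ J`, and `λ₁ U_n + λ₂ V_n` is the quadratic form with matrix
`λ₁ I + (λ₂ / 2) J`. Both are polynomials in `J`, so the discrete sine transform, which
diagonalises `J` with eigenvalues `2 cos θ_k`, `θ_k = kπ / (n + 1)`, turns `λ₁ U_n + λ₂ V_n` into a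
sum of squares of independent centred Gaussians. With the symbol
`G(c) = 1 - 2 (λ₁ + λ₂ c) (1 + φ² + 2φc) = (p - 2s) + 2 q c + 4 s c²` this gives
`𝔼 exp (λ₁ U_n + λ₂ V_n) = ∏ G(cos θ_k) ^ (-1/2)`, infinite as soon as one factor `G(cos θ_k)` is
nonpositive (`L_of_symbol_pos`, `L_eq_top`). As `D_{n,λ}` is `G` evaluated at `J / 2`, the same
product is its determinant (`det_D`, `posDef_D`).

The domain `D_λ` is exactly the set where `G ≥ 0` on `[-1, 1]` (`symbol_nonneg_of_mem_dom`,
`mem_dom_of_symbol_nonneg`). Outside it, `G` is negative on an interval, which meets the nodes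
`cos θ_k` for all large `n`. Inside it, a zero of `G` in `(-1, 1)` is a double zero; the parameters
with a double zero at `c` form a curve in `c`, and `D_λ^0` consists of its points over the nodes.
These are dense, so off the closure `G > 0` on `(-1, 1)` (`symbol_pos`).

For the limit no integral is needed. Write `G(c) = (p - 2s) (1 + A c) (1 + B c)`. The product
`∏ (1 + a cos θ_k)` is a rescaled Chebyshev polynomial of the second kind and satisfies a
three-term recurrence with characteristic roots `(1 ± √(1 - a²)) / 2`; its exponential growth rate
is the modulus of the dominant root (`tendsto_log_norm_chebProd`). This covers the boundary case
`a² = 1`, where `G` vanishes at an endpoint of `[-1, 1]`.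
-/

namespace MA1

/-! ### The path matrix and its orthogonal diagonalisation -/

/-- The adjacency matrix of the path with `n` vertices. -/
def pathMatrix (n : ℕ) : Matrix (Fin n) (Fin n) ℝ :=
  Matrix.of fun i j => if (i : ℕ) + 1 = j ∨ (j : ℕ) + 1 = i then 1 else 0

/-- The angle `(k + 1)π / (n + 1)`; the eigenvalues of `pathMatrix n` are `2 cos (angle n k)` for
`k < n`. -/
noncomputable def angle (n k : ℕ) : ℝ := (k + 1) * Real.pi / (n + 1)

/-- The Szegő symbol of the matrices `D φ l n`, as a function of `c = cos θ`: `D φ l n` is the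
polynomial `symbol φ l` evaluated at half the adjacency matrix of the path. -/
def symbol (φ : ℝ) (l : ℝ × ℝ) (c : ℝ) : ℝ :=
  1 - 2 * (l.1 + l.2 * c) * (1 + φ ^ 2 + 2 * φ * c)

theorem symbol_eq (φ : ℝ) (l : ℝ × ℝ) (c : ℝ) :
    symbol φ l c = (p φ l - 2 * s φ l) + 2 * q φ l * c + 4 * s φ l * c ^ 2 := by
  simp only [symbol, p, q, s]; ring

theorem continuous_symbol (φ : ℝ) (l : ℝ × ℝ) : Continuous (symbol φ l) := by
  unfold symbol; fun_prop

theorem angle_pos (n k : ℕ) : 0 < angle n k := by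
  unfold angle; positivity

theorem angle_lt_pi {n k : ℕ} (h : k < n) : angle n k < Real.pi := by
  unfold angle
  rw [div_lt_iff₀ (by positivity), mul_comm]
  gcongr

theorem pathMatrix_transpose (n : ℕ) : (pathMatrix n).transpose = pathMatrix n := by
  ext i j
  simp only [pathMatrix, Matrix.transpose_apply, Matrix.of_apply, or_comm]

/-- Row `i` of the path matrix applied to `g`: the sum of the values at the existing neighbours. -/
theorem sum_pathMatrix_mul {n : ℕ} (i : Fin n) (g : ℕ → ℝ) :
    ∑ j : Fin n, pathMatrix n i j * g j =
      (if (i : ℕ) + 1 < n then g (i + 1) else 0) + (if 0 < (i : ℕ) then g (i - 1) else 0) := by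
  have h : ∀ j : Fin n, pathMatrix n i j * g j =
      (if (i : ℕ) + 1 = j then g j else 0) + (if (i : ℕ) = j + 1 then g j else 0) := by
    intro j
    simp only [pathMatrix, Matrix.of_apply]
    split_ifs <;> first | omega | simp
  rw [Finset.sum_congr rfl fun j _ => h j, Finset.sum_add_distrib,
    Fin.sum_univ_eq_sum_range (fun j => if (i : ℕ) + 1 = j then g j else 0),
    Fin.sum_univ_eq_sum_range (fun j => if (i : ℕ) = j + 1 then g j else 0)]
  congr 1
  · simp
  · rcases Nat.eq_zero_or_pos (i : ℕ) with h0 | h0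
    · simp [h0]
    · rw [if_pos h0, Finset.sum_eq_single_of_mem ((i : ℕ) - 1)]
      · rw [if_pos (by omega)]
      · simp; omega
      · intro b _ hb
        rw [if_neg (by omega)]

/-- The unnormalised sine vectors, `k`-th column `i ↦ sin ((i + 1) θ_k)`. -/
noncomputable def sineMatrix (n : ℕ) : Matrix (Fin n) (Fin n) ℝ :=
  Matrix.of fun i k => Real.sin ((i + 1) * angle n k)

theorem pathMatrix_mul_sineMatrix (n : ℕ) :
    pathMatrix n * sineMatrix n =
      sineMatrix n * Matrix.diagonal fun k : Fin n => 2 * Real.cos (angle n k) := by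
  ext i k
  rw [Matrix.mul_apply, Matrix.mul_diagonal]
  simp only [sineMatrix, Matrix.of_apply]
  rw [sum_pathMatrix_mul i fun j => Real.sin ((j + 1) * angle n k)]
  have h1 : (if (i : ℕ) + 1 < n then Real.sin (((i + 1 : ℕ) + 1) * angle n k) else 0) =
      Real.sin ((i + 1) * angle n k + angle n k) := by
    split_ifs with h
    · push_cast; ring_nf
    · have hi : (n : ℝ) = i + 1 := by
        have := i.2
        exact_mod_cast (by omega : n = i + 1)
      have : ((i : ℝ) + 1) * angle n k + angle n k = ((k + 1 : ℕ) : ℝ) * Real.pi := by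
        unfold angle
        rw [← hi]
        push_cast
        field_simp
      rw [this, Real.sin_nat_mul_pi]
  have h2 : (if 0 < (i : ℕ) then Real.sin (((i - 1 : ℕ) + 1) * angle n k) else 0) =
      Real.sin ((i + 1) * angle n k - angle n k) := by
    split_ifs with h
    · rw [Nat.cast_sub h]; push_cast; ring_nf
    · have : (i : ℝ) = 0 := by exact_mod_cast (by omega : (i : ℕ) = 0)
      simp [this]
  rw [h1, h2, Real.sin_add, Real.sin_sub]
  ring

theorem cos_angle_injective (n : ℕ) : Function.Injective fun k : Fin n => Real.cos (angle n k) := by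
  intro j k h
  have := Real.injOn_cos ⟨(angle_pos n j).le, (angle_lt_pi j.2).le⟩
    ⟨(angle_pos n k).le, (angle_lt_pi k.2).le⟩ h
  unfold angle at this
  field_simp at this
  ext
  exact_mod_cast add_right_cancel this

/-- Columns of the sine matrix are eigenvectors of a symmetric matrix for distinct eigenvalues,
so the Gram matrix is diagonal; its diagonal is positive because `sin θ_k ≠ 0`. -/
theorem sineMatrix_gram (n : ℕ) :
    ∃ N : Fin n → ℝ, (∀ k, 0 < N k) ∧
      (sineMatrix n).transpose * sineMatrix n = Matrix.diagonal N := by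
  set W := sineMatrix n with hW
  set E : Matrix (Fin n) (Fin n) ℝ :=
    Matrix.diagonal fun k : Fin n => 2 * Real.cos (angle n k) with hE
  have hcomm : W.transpose * W * E = E * (W.transpose * W) := by
    have h := pathMatrix_mul_sineMatrix n
    rw [← hW, ← hE] at h
    have h' : W.transpose * pathMatrix n = E * W.transpose := by
      have := congrArg Matrix.transpose h
      rwa [Matrix.transpose_mul, Matrix.transpose_mul, pathMatrix_transpose, hE,
        Matrix.diagonal_transpose] at this
    rw [Matrix.mul_assoc, ← h, ← Matrix.mul_assoc, h', Matrix.mul_assoc]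
  refine ⟨fun k => (W.transpose * W) k k, fun k => ?_, ?_⟩
  · change 0 < (W.transpose * W) k k
    rw [Matrix.mul_apply]
    have hn : 0 < n := k.pos
    refine Finset.sum_pos' (fun i _ => ?_) ⟨⟨0, hn⟩, Finset.mem_univ _, ?_⟩
    · exact mul_self_nonneg _
    · have : 0 < Real.sin (angle n k) := Real.sin_pos_of_pos_of_lt_pi (angle_pos n k)
        (angle_lt_pi k.2)
      simp only [hW, sineMatrix, Matrix.transpose_apply, Matrix.of_apply]
      simpa using mul_pos this this
  · ext j k
    rcases eq_or_ne j k with rfl | hjk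
    · simp
    · rw [Matrix.diagonal_apply_ne _ hjk]
      have h := congrFun (congrFun hcomm j) k
      rw [hE, Matrix.mul_diagonal, Matrix.diagonal_mul] at h
      have hne := fun h => hjk (cos_angle_injective n h)
      have : (W.transpose * W) j k * (Real.cos (angle n k) - Real.cos (angle n j)) = 0 := by
        linarith
      rcases mul_eq_zero.1 this with h | h
      · exact h
      · exact absurd (sub_eq_zero.1 h).symm hne

/-- The discrete sine transform diagonalises the path matrix orthogonally. -/
theorem exists_orthogonal_diagonalization (n : ℕ) :
    ∃ V : Matrix (Fin n) (Fin n) ℝ, V.transpose * V = 1 ∧ V * V.transpose = 1 ∧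
      pathMatrix n =
        V * (Matrix.diagonal fun k : Fin n => 2 * Real.cos (angle n k)) * V.transpose := by
  obtain ⟨N, hN, hG⟩ := sineMatrix_gram n
  set R : Matrix (Fin n) (Fin n) ℝ := Matrix.diagonal fun k => (√(N k))⁻¹ with hR
  have h1 : (sineMatrix n * R).transpose * (sineMatrix n * R) = 1 := by
    rw [Matrix.transpose_mul, Matrix.mul_assoc, ← Matrix.mul_assoc _ _ R, hG, hR,
      Matrix.diagonal_transpose, Matrix.diagonal_mul_diagonal, Matrix.diagonal_mul_diagonal,
      ← Matrix.diagonal_one]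
    congr 1
    ext k
    have := Real.sqrt_pos.2 (hN k)
    nth_rw 2 [← Real.mul_self_sqrt (hN k).le]
    field_simp
  have h2 := mul_eq_one_comm.1 h1
  refine ⟨sineMatrix n * R, h1, h2, ?_⟩
  have h3 : pathMatrix n * (sineMatrix n * R) =
      sineMatrix n * R * Matrix.diagonal fun k : Fin n => 2 * Real.cos (angle n k) := by
    rw [← Matrix.mul_assoc, pathMatrix_mul_sineMatrix, Matrix.mul_assoc, Matrix.mul_assoc, hR,
      Matrix.diagonal_mul_diagonal, Matrix.diagonal_mul_diagonal]
    simp only [mul_comm]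
  rw [← h3, Matrix.mul_assoc, h2, Matrix.mul_one]

/-- `D` is a quadratic polynomial in the path matrix: the square of the path matrix has
`1, 2, …, 2, 1` on the diagonal, which accounts for the corner entries `r = p - 2s + s`. -/
theorem D_eq_polynomial (φ : ℝ) (l : ℝ × ℝ) {n : ℕ} (hn : 2 ≤ n) :
    D φ l n = (p φ l - 2 * s φ l) • (1 : Matrix (Fin n) (Fin n) ℝ) + q φ l • pathMatrix n +
      s φ l • (pathMatrix n * pathMatrix n) := by
  have hr : r φ l = p φ l - s φ l := by simp only [r, p, s]; ring
  ext i j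
  have hsq : (pathMatrix n * pathMatrix n) i j =
      (if (i : ℕ) + 1 < n then (if (i : ℕ) + 2 = j ∨ (i : ℕ) = j then 1 else 0) else 0) +
      (if 0 < (i : ℕ) then (if (i : ℕ) = j ∨ (j : ℕ) + 2 = i then 1 else 0) else 0) := by
    have := sum_pathMatrix_mul i fun k => if k + 1 = (j : ℕ) ∨ (j : ℕ) + 1 = k then 1 else 0
    rw [Matrix.mul_apply]
    refine this.trans ?_
    congr 1
    · simp only [add_assoc, Nat.reduceAdd, add_left_inj, eq_comm]
    · split_ifs <;> first | omega | rfl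
  rw [Matrix.add_apply, Matrix.add_apply, Matrix.smul_apply, Matrix.smul_apply,
    Matrix.smul_apply, hsq]
  simp only [D, Matrix.of_apply, Matrix.one_apply,
    pathMatrix, smul_eq_mul, hr, Fin.ext_iff]
  have hi := i.2
  have hj := j.2
  split_ifs <;> first | omega | ring

theorem exists_orthogonal_diagonalization_D (φ : ℝ) (l : ℝ × ℝ) {n : ℕ} (hn : 2 ≤ n) :
    ∃ V : Matrix (Fin n) (Fin n) ℝ, V.transpose * V = 1 ∧ V * V.transpose = 1 ∧
      D φ l n =
        V * (Matrix.diagonal fun k : Fin n => symbol φ l (Real.cos (angle n k))) *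
          V.transpose := by
  obtain ⟨V, h1, h2, hJ⟩ := exists_orthogonal_diagonalization n
  refine ⟨V, h1, h2, ?_⟩
  set E : Matrix (Fin n) (Fin n) ℝ :=
    Matrix.diagonal fun k : Fin n => 2 * Real.cos (angle n k) with hE
  have hJ2 : pathMatrix n * pathMatrix n = V * (E * E) * V.transpose := by
    calc pathMatrix n * pathMatrix n = V * E * (V.transpose * V) * E * V.transpose := by
          rw [hJ]; simp only [Matrix.mul_assoc]
      _ = V * (E * E) * V.transpose := by
          rw [h1, Matrix.mul_one]; simp only [Matrix.mul_assoc]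
  have hdiag : (Matrix.diagonal fun k : Fin n => symbol φ l (Real.cos (angle n k))) =
      (p φ l - 2 * s φ l) • (1 : Matrix (Fin n) (Fin n) ℝ) + q φ l • E + s φ l • (E * E) := by
    rw [hE, Matrix.diagonal_mul_diagonal, ← Matrix.diagonal_one, ← Matrix.diagonal_smul,
      ← Matrix.diagonal_smul, ← Matrix.diagonal_smul, Matrix.diagonal_add, Matrix.diagonal_add]
    congr 1
    ext k
    simp only [symbol_eq, Pi.smul_apply, smul_eq_mul]
    ring
  rw [D_eq_polynomial φ l hn, hdiag, hJ2, hJ]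
  simp only [Matrix.mul_add, Matrix.add_mul, Matrix.mul_smul, Matrix.smul_mul, Matrix.mul_one, h2]

theorem det_D (φ : ℝ) (l : ℝ × ℝ) {n : ℕ} (hn : 2 ≤ n) :
    (D φ l n).det = ∏ k : Fin n, symbol φ l (Real.cos (angle n k)) := by
  obtain ⟨V, -, h2, hD⟩ := exists_orthogonal_diagonalization_D φ l hn
  rw [hD, Matrix.det_mul_right_comm, h2, Matrix.one_mul, Matrix.det_diagonal]

theorem posDef_D (φ : ℝ) (l : ℝ × ℝ) {n : ℕ} (hn : 2 ≤ n)
    (h : ∀ k < n, 0 < symbol φ l (Real.cos (angle n k))) : (D φ l n).PosDef := by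
  obtain ⟨V, h1, h2, hD⟩ := exists_orthogonal_diagonalization_D φ l hn
  rw [hD, ← Matrix.conjTranspose_eq_transpose_of_trivial]
  refine (Matrix.PosDef.diagonal fun k : Fin n => h k k.2).mul_mul_conjTranspose_same ?_
  exact Matrix.vecMul_injective_of_isUnit (IsUnit.of_mul_eq_one _ h2)

/-! ### Gaussian Laplace transforms -/

/-- The Gaussian density is absorbed into the exponential; the sign of `1 - 2 a v` then decides
whether the integral is finite. -/
theorem lintegral_exp_mul_sq_gaussianReal_eq (a : ℝ) {v : NNReal} (hv : v ≠ 0) :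
    ∫⁻ y, ENNReal.ofReal (Real.exp (a * y ^ 2)) ∂(gaussianReal 0 v) =
      ∫⁻ y, ENNReal.ofReal ((√(2 * Real.pi * v))⁻¹ *
        Real.exp (-((1 - 2 * a * v) / (2 * v)) * y ^ 2)) := by
  have hv' : (v : ℝ) ≠ 0 := by exact_mod_cast hv
  rw [gaussianReal_of_var_ne_zero _ hv,
    lintegral_withDensity_eq_lintegral_mul _ (measurable_gaussianPDF 0 v) (by fun_prop)]
  refine lintegral_congr fun y => ?_
  rw [Pi.mul_apply, gaussianPDF, ← ENNReal.ofReal_mul (gaussianPDFReal_nonneg _ _ _),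
    gaussianPDFReal, mul_assoc, ← Real.exp_add]
  congr 3
  field_simp
  ring

theorem lintegral_exp_mul_sq_gaussianReal {a : ℝ} {v : NNReal} (hv : v ≠ 0)
    (h : 0 < 1 - 2 * a * v) :
    ∫⁻ y, ENNReal.ofReal (Real.exp (a * y ^ 2)) ∂(gaussianReal 0 v) =
      ENNReal.ofReal (√(1 - 2 * a * v))⁻¹ := by
  have hv' : 0 < (v : ℝ) := by positivity
  have hb : 0 < (1 - 2 * a * v) / (2 * v) := by positivity
  rw [lintegral_exp_mul_sq_gaussianReal_eq a hv, ← ofReal_integral_eq_lintegral_ofReal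
    ((integrable_exp_neg_mul_sq hb).const_mul _) (ae_of_all _ fun y => by positivity),
    integral_const_mul, integral_gaussian]
  congr 1
  rw [← Real.sqrt_inv, ← Real.sqrt_inv, ← Real.sqrt_mul (by positivity)]
  congr 1
  field_simp

theorem lintegral_exp_mul_sq_gaussianReal_eq_top {a : ℝ} {v : NNReal} (hv : v ≠ 0)
    (h : 1 - 2 * a * v ≤ 0) :
    ∫⁻ y, ENNReal.ofReal (Real.exp (a * y ^ 2)) ∂(gaussianReal 0 v) = ⊤ := by
  have hv' : 0 < (v : ℝ) := by positivity
  rw [lintegral_exp_mul_sq_gaussianReal_eq a hv, eq_top_iff]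
  calc (⊤ : ENNReal) = ∫⁻ _ : ℝ, ENNReal.ofReal ((√(2 * Real.pi * v))⁻¹) := by
        rw [lintegral_const, Real.volume_univ, ENNReal.mul_top]
        simp only [ne_eq, ENNReal.ofReal_eq_zero, not_le]
        positivity
    _ ≤ _ := by
        refine lintegral_mono fun y => ENNReal.ofReal_le_ofReal ?_
        refine le_mul_of_one_le_right (by positivity) (Real.one_le_exp ?_)
        have : (1 - 2 * a * v) / (2 * v) ≤ 0 := div_nonpos_of_nonpos_of_nonneg h (by positivity)
        nlinarith [sq_nonneg y]

theorem lintegral_prod_comp_eq_prod_lintegral_map {Ω ι : Type*} [MeasurableSpace Ω]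
    {P : Measure Ω} [IsProbabilityMeasure P] [Fintype ι] {Y : ι → Ω → ℝ}
    (hY : ∀ i, AEMeasurable (Y i) P) (hi : iIndepFun Y P) {f : ι → ℝ → ENNReal}
    (hf : ∀ i, Measurable (f i)) :
    ∫⁻ ω, ∏ i, f i (Y i ω) ∂P = ∏ i, ∫⁻ y, f i y ∂(P.map (Y i)) := by
  have hprob : ∀ i, IsProbabilityMeasure (P.map (Y i)) := fun i =>
    Measure.isProbabilityMeasure_map (hY i)
  have hm : AEMeasurable (fun ω i => Y i ω) P := aemeasurable_pi_lambda _ hY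
  have hind : iIndepFun (fun i (y : ι → ℝ) => f i (y i)) (Measure.pi fun i => P.map (Y i)) :=
    iIndepFun_pi (X := fun i y => f i y) fun i => (hf i).aemeasurable
  calc ∫⁻ ω, ∏ i, f i (Y i ω) ∂P
      = ∫⁻ y : ι → ℝ, ∏ i, f i (y i) ∂(P.map fun ω i => Y i ω) := by
        have hp : Measurable fun y : ι → ℝ => ∏ i, f i (y i) :=
          Finset.measurable_prod _ fun i _ => (hf i).comp (measurable_pi_apply i)
        rw [lintegral_map' hp.aemeasurable hm]
    _ = ∏ i, ∫⁻ y : ι → ℝ, f i (y i) ∂(Measure.pi fun i => P.map (Y i)) := by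
        rw [(iIndepFun_iff_map_fun_eq_pi_map hY).1 hi,
          lintegral_prod_eq_prod_lintegral_of_indepFun _ _ hind (by fun_prop)]
    _ = ∏ i, ∫⁻ y, f i y ∂(P.map (Y i)) := by
        refine Finset.prod_congr rfl fun i _ => ?_
        exact (measurePreserving_eval (fun i => P.map (Y i)) i).lintegral_comp (hf i)

/-- The eigenvalue `1 + φ² + 2φc` of the covariance matrix is positive. -/
theorem spectralDensity_pos (hφ : |φ| < 1) {c : ℝ} (hc : c ∈ Set.Icc (-1) 1) :
    0 < 1 + φ ^ 2 + 2 * φ * c := by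
  have h1 : |φ * c| ≤ |φ| := by
    rw [abs_mul]
    exact mul_le_of_le_one_right (abs_nonneg φ) (abs_le.2 hc)
  have h2 : 0 < (1 - |φ|) ^ 2 := by
    have := sub_pos.2 hφ
    positivity
  nlinarith [neg_le_of_abs_le h1, sq_abs φ]

theorem sum_mul_sum_pathMatrix_mul (n : ℕ) (g : ℕ → ℝ) :
    ∑ i : Fin n, g i * ∑ j : Fin n, pathMatrix n i j * g j =
      2 * ∑ i ∈ Finset.range (n - 1), g (i + 1) * g i := by
  simp only [sum_pathMatrix_mul]
  rw [Fin.sum_univ_eq_sum_range (fun i => g i * ((if i + 1 < n then g (i + 1) else 0) +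
    if 0 < i then g (i - 1) else 0))]
  simp only [mul_add]
  rw [Finset.sum_add_distrib, two_mul]
  rcases n with _ | m
  · simp
  rw [Nat.add_sub_cancel]
  congr 1
  · rw [Finset.sum_range_succ, if_neg (lt_irrefl _), mul_zero, add_zero]
    refine Finset.sum_congr rfl fun i hi => ?_
    rw [if_pos (by simpa using hi), mul_comm]
  · rw [Finset.sum_range_succ']
    simp

theorem U_eq_sum_range {Ω : Type*} (φ : ℝ) (ε : ℕ → Ω → ℝ) (n : ℕ) (ω : Ω) :
    U φ ε n ω = ∑ i ∈ Finset.range n, X φ ε (i + 1) ω ^ 2 := by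
  rw [U, Finset.range_eq_Ico, Finset.sum_Ico_add' (fun k => X φ ε k ω ^ 2) 0 n 1]
  rfl

theorem V_eq_sum_range {Ω : Type*} (φ : ℝ) (ε : ℕ → Ω → ℝ) (n : ℕ) (ω : Ω) :
    V φ ε n ω =
      ∑ i ∈ Finset.range (n - 1), X φ ε (i + 1 + 1) ω * X φ ε (i + 1) ω := by
  have h := Finset.sum_Ico_add' (fun k => X φ ε k ω * X φ ε (k - 1) ω) 0 (n - 1) 2
  rw [V, Finset.range_eq_Ico]
  refine Eq.trans (Finset.sum_congr ?_ fun _ _ => rfl) h.symm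
  ext k
  simp only [Finset.mem_Icc, Finset.mem_Ico]
  omega

section GaussianVector

variable {Ω : Type*} [MeasurableSpace Ω] {P : Measure Ω} {φ : ℝ}
  {ε : ℕ → Ω → ℝ}

theorem covariance_noise (hlaw : ∀ n, HasLaw (ε n) (gaussianReal 0 1) P) (hindep : iIndepFun ε P)
    (i j : ℕ) : cov[ε i, ε j; P] = if i = j then 1 else 0 := by
  have hL : ∀ n, MemLp (ε n) 2 P := fun n => (hlaw n).hasGaussianLaw.memLp_two
  split_ifs with h
  · subst h
    rw [covariance_self (hlaw i).aemeasurable, (hlaw i).variance_eq, variance_id_gaussianReal]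
    simp
  · exact (hindep.indepFun h).covariance_eq_zero (hL i) (hL j)

theorem mean_linear_X (hlaw : ∀ n, HasLaw (ε n) (gaussianReal 0 1) P) {n : ℕ}
    (w : Fin n → ℝ) : P[fun ω => ∑ i : Fin n, w i * X φ ε (i + 1) ω] = 0 := by
  have hI : ∀ n, Integrable (ε n) P := fun n => (hlaw n).hasGaussianLaw.integrable
  have h0 : ∀ n, ∫ ω, ε n ω ∂P = 0 := fun n => by
    rw [(hlaw n).integral_eq, integral_id_gaussianReal]
  have hIX : ∀ k, Integrable (X φ ε k) P := fun k => (hI k).add ((hI (k - 1)).const_mul φ)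
  rw [integral_finsetSum _ fun i _ => (hIX _).const_mul _]
  refine Finset.sum_eq_zero fun i _ => ?_
  rw [integral_const_mul]
  simp only [X]
  rw [integral_add (hI _) ((hI _).const_mul φ), integral_const_mul, h0, h0]
  simp

/-- The covariance matrix of `(X_1, …, X_n)` is `(1 + φ²) I + φ J`, `J` the path matrix. -/
theorem covariance_X (hlaw : ∀ n, HasLaw (ε n) (gaussianReal 0 1) P) (hindep : iIndepFun ε P)
    {n : ℕ} (i j : Fin n) :
    cov[X φ ε (i + 1), X φ ε (j + 1); P] =
      ((1 + φ ^ 2) • (1 : Matrix (Fin n) (Fin n) ℝ) + φ • pathMatrix n) i j := by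
  have hL : ∀ n, MemLp (ε n) 2 P := fun n => (hlaw n).hasGaussianLaw.memLp_two
  have := hindep.isProbabilityMeasure
  have hX : ∀ k : ℕ, X φ ε (k + 1) = ε (k + 1) + φ • ε k := fun k => by
    ext ω; simp [X]
  have hL' : ∀ n, MemLp (φ • ε n) 2 P := fun n => (hL n).const_smul φ
  rw [hX, hX, covariance_add_left (hL _) (hL' _) ((hL _).add (hL' _)),
    covariance_add_right (hL _) (hL _) (hL' _), covariance_add_right (hL' _) (hL _) (hL' _)]
  simp only [covariance_smul_left, covariance_smul_right, covariance_noise hlaw hindep,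
    Matrix.add_apply, Matrix.smul_apply, Matrix.one_apply, pathMatrix, Matrix.of_apply,
    smul_eq_mul, Fin.ext_iff]
  split_ifs <;> first | omega | ring

/-- `(X_1, …, X_n)` is a Gaussian vector, and so is every linear image of it. -/
theorem hasGaussianLaw_linear_X (hlaw : ∀ n, HasLaw (ε n) (gaussianReal 0 1) P)
    (hindep : iIndepFun ε P) {n : ℕ} (M : Matrix (Fin n) (Fin n) ℝ) :
    HasGaussianLaw (fun ω k => ∑ i : Fin n, M k i * X φ ε (i + 1) ω) P := by
  have hj : HasGaussianLaw (fun ω (i : Fin (n + 1)) => ε i ω) P :=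
    iIndepFun.hasGaussianLaw (fun i => (hlaw i).hasGaussianLaw)
      (hindep.precomp (g := fun i : Fin (n + 1) => (i : ℕ)) Fin.val_injective)
  let T : (Fin (n + 1) → ℝ) →ₗ[ℝ] (Fin n → ℝ) :=
    { toFun := fun e k => ∑ i : Fin n, M k i * (e i.succ + φ * e i.castSucc)
      map_add' := fun x y => by
        ext k
        simp only [Pi.add_apply, ← Finset.sum_add_distrib]
        exact Finset.sum_congr rfl fun i _ => by ring
      map_smul' := fun c x => by
        ext k
        simp only [Pi.smul_apply, smul_eq_mul, RingHom.id_apply, Finset.mul_sum]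
        exact Finset.sum_congr rfl fun i _ => by ring }
  exact hj.map_fun (LinearMap.toContinuousLinearMap T)

variable [IsProbabilityMeasure P]

/-- In the orthonormal eigenbasis of the path matrix the coordinates of `(X_1, …, X_n)` are
independent centred Gaussians, and `λ₁ U_n + λ₂ V_n` is a diagonal quadratic form: both the
covariance matrix and the matrix of the quadratic form are polynomials in the path matrix. -/
theorem exists_independent_coordinates
    (hlaw : ∀ n, HasLaw (ε n) (gaussianReal 0 1) P) (hindep : iIndepFun ε P) (n : ℕ) :
    ∃ Y : Fin n → Ω → ℝ,
      (∀ k, HasLaw (Y k)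
        (gaussianReal 0 (1 + φ ^ 2 + 2 * φ * Real.cos (angle n k)).toNNReal) P) ∧
      iIndepFun Y P ∧
      ∀ (l : ℝ × ℝ) (ω : Ω), l.1 * U φ ε n ω + l.2 * V φ ε n ω =
        ∑ k : Fin n, (l.1 + l.2 * Real.cos (angle n k)) * Y k ω ^ 2 := by
  obtain ⟨W, h1, h2, hJ⟩ := exists_orthogonal_diagonalization n
  have hJ' : W.transpose * pathMatrix n * W =
      Matrix.diagonal fun k : Fin n => 2 * Real.cos (angle n k) := by
    calc W.transpose * pathMatrix n * W = (W.transpose * W) *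
          (Matrix.diagonal fun k : Fin n => 2 * Real.cos (angle n k)) * (W.transpose * W) := by
          rw [hJ]; simp only [Matrix.mul_assoc]
      _ = _ := by rw [h1, Matrix.mul_one, Matrix.one_mul]
  set Y : Fin n → Ω → ℝ := fun k ω => ∑ i : Fin n, W.transpose k i * X φ ε (i + 1) ω with hY
  have hG : HasGaussianLaw (fun ω k => Y k ω) P :=
    hasGaussianLaw_linear_X hlaw hindep W.transpose
  have hXL : ∀ k, MemLp (X φ ε k) 2 P := fun k =>
    (hlaw k).hasGaussianLaw.memLp_two.add ((hlaw (k - 1)).hasGaussianLaw.memLp_two.const_mul φ)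
  have hcov : ∀ j k, cov[Y j, Y k; P] = (Matrix.diagonal fun k : Fin n =>
      1 + φ ^ 2 + 2 * φ * Real.cos (angle n k)) j k := by
    intro j k
    have hmat : (Matrix.diagonal fun k : Fin n => 1 + φ ^ 2 + 2 * φ * Real.cos (angle n k)) =
        W.transpose * ((1 + φ ^ 2) • (1 : Matrix (Fin n) (Fin n) ℝ) + φ • pathMatrix n) * W := by
      rw [Matrix.mul_add, Matrix.add_mul, Matrix.mul_smul, Matrix.mul_smul, Matrix.smul_mul,
        Matrix.smul_mul, hJ', Matrix.mul_one, h1, ← Matrix.diagonal_one, ← Matrix.diagonal_smul,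
        ← Matrix.diagonal_smul, Matrix.diagonal_add]
      congr 1
      ext k
      simp only [Pi.smul_apply, smul_eq_mul]
      ring
    rw [hmat, covariance_fun_sum_fun_sum (fun i => (hXL _).const_mul _)
      (fun i => (hXL _).const_mul _), Finset.sum_comm, Matrix.mul_apply]
    refine Finset.sum_congr rfl fun b _ => ?_
    rw [Matrix.mul_apply, Finset.sum_mul]
    refine Finset.sum_congr rfl fun a _ => ?_
    rw [covariance_const_mul_left, covariance_const_mul_right, covariance_X hlaw hindep,
      Matrix.transpose_apply, Matrix.transpose_apply]
    ring
  refine ⟨Y, fun k => ⟨(hG.eval k).aemeasurable, ?_⟩,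
    hG.iIndepFun_of_covariance_eq_zero fun i j hij => ?_, fun l ω => ?_⟩
  · rw [(hG.eval k).map_eq_gaussianReal, mean_linear_X hlaw,
      ← covariance_self (hG.eval k).aemeasurable, hcov, Matrix.diagonal_apply_eq]
  · rw [hcov, Matrix.diagonal_apply_ne _ hij]
  · set x : Fin n → ℝ := fun i => X φ ε (i + 1) ω with hx
    have hy : (fun k => Y k ω) = W.transpose.mulVec x := rfl
    have hyx : W.mulVec (fun k => Y k ω) = x := by
      rw [hy, Matrix.mulVec_mulVec, h2, Matrix.one_mulVec]
    have hU : U φ ε n ω = ∑ k, Y k ω ^ 2 := by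
      calc U φ ε n ω = x ⬝ᵥ x := by
            rw [U_eq_sum_range, ← Fin.sum_univ_eq_sum_range fun i => X φ ε (i + 1) ω ^ 2]
            exact Finset.sum_congr rfl fun i _ => sq _
        _ = (fun k => Y k ω) ⬝ᵥ fun k => Y k ω := by
            nth_rw 1 [← hyx]
            rw [dotProduct_comm, Matrix.dotProduct_mulVec, ← Matrix.mulVec_transpose, hy]
        _ = _ := Finset.sum_congr rfl fun k _ => (sq _).symm
    have hV : 2 * V φ ε n ω = ∑ k : Fin n, 2 * Real.cos (angle n k) * Y k ω ^ 2 := by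
      calc 2 * V φ ε n ω = x ⬝ᵥ (pathMatrix n).mulVec x := by
            rw [V_eq_sum_range, ← sum_mul_sum_pathMatrix_mul n fun i => X φ ε (i + 1) ω]
            rfl
        _ = (fun k => Y k ω) ⬝ᵥ (Matrix.diagonal fun k : Fin n =>
              2 * Real.cos (angle n k)).mulVec fun k => Y k ω := by
            rw [← hJ', ← Matrix.mulVec_mulVec, hyx, ← Matrix.mulVec_mulVec,
              Matrix.dotProduct_mulVec (fun k => Y k ω), ← Matrix.mulVec_transpose,
              Matrix.transpose_transpose, hyx]
        _ = _ := by
            refine Finset.sum_congr rfl fun k _ => ?_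
            rw [Matrix.mulVec_diagonal]
            ring
    have hV' : V φ ε n ω = ∑ k : Fin n, Real.cos (angle n k) * Y k ω ^ 2 := by
      rw [← mul_right_inj' (two_ne_zero (α := ℝ)), hV, Finset.mul_sum]
      exact Finset.sum_congr rfl fun k _ => by ring
    rw [hU, hV', Finset.mul_sum, Finset.mul_sum, ← Finset.sum_add_distrib]
    exact Finset.sum_congr rfl fun k _ => by ring

theorem lintegral_exp_eq_prod
    (hlaw : ∀ n, HasLaw (ε n) (gaussianReal 0 1) P) (hindep : iIndepFun ε P) (n : ℕ)
    (l : ℝ × ℝ) :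
    ∫⁻ ω, ENNReal.ofReal (Real.exp (l.1 * U φ ε n ω + l.2 * V φ ε n ω)) ∂P =
      ∏ k : Fin n, ∫⁻ y, ENNReal.ofReal (Real.exp ((l.1 + l.2 * Real.cos (angle n k)) * y ^ 2))
        ∂(gaussianReal 0 (1 + φ ^ 2 + 2 * φ * Real.cos (angle n k)).toNNReal) := by
  obtain ⟨Y, hY, hi, hq⟩ := exists_independent_coordinates hlaw hindep n
  set f : Fin n → ℝ → ENNReal := fun k y =>
    ENNReal.ofReal (Real.exp ((l.1 + l.2 * Real.cos (angle n k)) * y ^ 2)) with hf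
  have hfm : ∀ k, Measurable (f k) := fun k => by
    simp only [hf]
    fun_prop
  have hpoint : ∀ ω, ENNReal.ofReal (Real.exp (l.1 * U φ ε n ω + l.2 * V φ ε n ω)) =
      ∏ k, f k (Y k ω) := fun ω => by
    rw [hq, Real.exp_sum, ENNReal.ofReal_prod_of_nonneg fun _ _ => (Real.exp_pos _).le]
  rw [lintegral_congr hpoint,
    lintegral_prod_comp_eq_prod_lintegral_map (fun i => (hY i).aemeasurable) hi hfm]
  exact Finset.prod_congr rfl fun k _ => by rw [(hY k).map_eq]

/-- The variances of the eigen-coordinates are positive, so `Real.toNNReal` does not truncate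
them. -/
theorem spectralDensity_angle (hφ : |φ| < 1) (n k : ℕ) :
    (1 + φ ^ 2 + 2 * φ * Real.cos (angle n k)).toNNReal ≠ 0 ∧
      (((1 + φ ^ 2 + 2 * φ * Real.cos (angle n k)).toNNReal : NNReal) : ℝ) =
        1 + φ ^ 2 + 2 * φ * Real.cos (angle n k) := by
  have h := spectralDensity_pos hφ ⟨Real.neg_one_le_cos (angle n k), Real.cos_le_one _⟩
  exact ⟨(Real.toNNReal_pos.2 h).ne', Real.coe_toNNReal _ h.le⟩

/-- The Laplace transform of the pair `(U_n, V_n)` inside its domain of finiteness. -/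
theorem lintegral_exp_of_symbol_pos (hφ : |φ| < 1)
    (hlaw : ∀ n, HasLaw (ε n) (gaussianReal 0 1) P) (hindep : iIndepFun ε P) {n : ℕ}
    {l : ℝ × ℝ} (h : ∀ k < n, 0 < symbol φ l (Real.cos (angle n k))) :
    ∫⁻ ω, ENNReal.ofReal (Real.exp (l.1 * U φ ε n ω + l.2 * V φ ε n ω)) ∂P =
      ENNReal.ofReal (√(∏ k : Fin n, symbol φ l (Real.cos (angle n k))))⁻¹ := by
  rw [lintegral_exp_eq_prod hlaw hindep, Real.sqrt_prod _ fun (k : Fin n) _ => (h k k.2).le,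
    ← Finset.prod_inv_distrib, ENNReal.ofReal_prod_of_nonneg fun _ _ => by positivity]
  refine Finset.prod_congr rfl fun k _ => ?_
  obtain ⟨h1, h2⟩ := spectralDensity_angle hφ n k
  have hk := h k k.2
  rw [symbol, ← h2] at hk
  rw [lintegral_exp_mul_sq_gaussianReal h1 hk, symbol, h2]

theorem lintegral_exp_eq_top (hφ : |φ| < 1)
    (hlaw : ∀ n, HasLaw (ε n) (gaussianReal 0 1) P) (hindep : iIndepFun ε P) {n k : ℕ}
    (hkn : k < n) {l : ℝ × ℝ} (h : symbol φ l (Real.cos (angle n k)) ≤ 0) :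
    ∫⁻ ω, ENNReal.ofReal (Real.exp (l.1 * U φ ε n ω + l.2 * V φ ε n ω)) ∂P = ⊤ := by
  rw [lintegral_exp_eq_prod hlaw hindep, ← Finset.mul_prod_erase _ _
    (Finset.mem_univ (⟨k, hkn⟩ : Fin n))]
  obtain ⟨h1, h2⟩ := spectralDensity_angle hφ n k
  rw [symbol, ← h2] at h
  rw [lintegral_exp_mul_sq_gaussianReal_eq_top h1 h, ENNReal.top_mul]
  refine Finset.prod_ne_zero_iff.2 fun j _ => ?_
  obtain ⟨g1, g2⟩ := spectralDensity_angle hφ n j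
  rcases le_or_gt (1 - 2 * (l.1 + l.2 * Real.cos (angle n j)) *
    ((1 + φ ^ 2 + 2 * φ * Real.cos (angle n j)).toNNReal : NNReal)) 0 with hj | hj
  · rw [lintegral_exp_mul_sq_gaussianReal_eq_top g1 hj]
    exact ENNReal.top_ne_zero
  · rw [lintegral_exp_mul_sq_gaussianReal g1 hj]
    exact (ENNReal.ofReal_pos.2 (inv_pos.2 (Real.sqrt_pos.2 hj))).ne'

theorem L_of_symbol_pos (hφ : |φ| < 1)
    (hlaw : ∀ n, HasLaw (ε n) (gaussianReal 0 1) P) (hindep : iIndepFun ε P) {n : ℕ}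
    {l : ℝ × ℝ} (h : ∀ k < n, 0 < symbol φ l (Real.cos (angle n k))) :
    L P φ ε n l = ((-(1 / (2 * (n : ℝ))) *
      Real.log (∏ k : Fin n, symbol φ l (Real.cos (angle n k))) : ℝ) : EReal) := by
  have hpos : 0 < ∏ k : Fin n, symbol φ l (Real.cos (angle n k)) :=
    Finset.prod_pos fun (k : Fin n) _ => h k k.2
  rw [L, lintegral_exp_of_symbol_pos hφ hlaw hindep h, ENNReal.log_ofReal_of_pos (by positivity),
    ← EReal.coe_mul, Real.log_inv, Real.log_sqrt hpos.le]
  congr 1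
  ring

theorem L_eq_top (hφ : |φ| < 1)
    (hlaw : ∀ n, HasLaw (ε n) (gaussianReal 0 1) P) (hindep : iIndepFun ε P) {n k : ℕ}
    (hkn : k < n) {l : ℝ × ℝ} (h : symbol φ l (Real.cos (angle n k)) ≤ 0) :
    L P φ ε n l = ⊤ := by
  have hn : (0 : ℝ) < n := by exact_mod_cast k.zero_le.trans_lt hkn
  rw [L, lintegral_exp_eq_top hφ hlaw hindep hkn h, ENNReal.log_top]
  exact EReal.coe_mul_top_of_pos (by positivity)

end GaussianVector

/-! ### Products of linear factors over the Chebyshev nodes -/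

/-- Chebyshev polynomials of the second kind have leading coefficient `2 ^ n` and roots
`cos θ_k`. -/
theorem U_real_eq_prod (n : ℕ) : Polynomial.Chebyshev.U ℝ n =
    Polynomial.C (2 ^ n) *
      ∏ k : Fin n, (Polynomial.X - Polynomial.C (Real.cos (angle n k))) := by
  have hroots := Polynomial.Chebyshev.roots_U_real n
  have hinj : Set.InjOn (fun k : ℕ => Real.cos ((k + 1) * Real.pi / (n + 1))) (Finset.range n) :=
    (Finset.range n).nodup_map_iff_injOn.mp (Polynomial.Chebyshev.roots_U_real_nodup n)
  have hcard : (Polynomial.Chebyshev.U ℝ n).roots.card =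
      (Polynomial.Chebyshev.U ℝ n).natDegree := by
    rw [hroots, Polynomial.Chebyshev.natDegree_U_natCast, Finset.card_val,
      Finset.card_image_of_injOn hinj, Finset.card_range]
  have h := Polynomial.C_leadingCoeff_mul_prod_multiset_X_sub_C hcard
  rw [Polynomial.Chebyshev.leadingCoeff_U_natCast, hroots] at h
  rw [← h]
  congr 1
  rw [Fin.prod_univ_eq_prod_range
    (fun k => (Polynomial.X - Polynomial.C (Real.cos (angle n k)) : Polynomial ℝ)) n]
  exact (Finset.prod_image
    (f := fun x : ℝ => (Polynomial.X - Polynomial.C x : Polynomial ℝ)) hinj)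

theorem U_complex_eval_eq_prod (n : ℕ) (x : ℂ) : (Polynomial.Chebyshev.U ℂ n).eval x =
    2 ^ n * ∏ k : Fin n, (x - (Real.cos (angle n k) : ℂ)) := by
  rw [← Polynomial.Chebyshev.map_U (algebraMap ℝ ℂ), U_real_eq_prod, Polynomial.map_mul,
    Polynomial.map_prod, Polynomial.eval_mul, Polynomial.eval_prod]
  simp

/-- `chebProd a n = ∏ (1 + a cos θ_k)`, the product of one linear factor of the symbol over the
eigenvalues. -/
noncomputable def chebProd (a : ℂ) (n : ℕ) : ℂ :=
  ∏ k : Fin n, (1 + a * (Real.cos (angle n k) : ℂ))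

theorem chebProd_eq (a : ℂ) (ha : a ≠ 0) (n : ℕ) :
    chebProd a n = (-a / 2) ^ n * (Polynomial.Chebyshev.U ℂ n).eval (-a⁻¹) := by
  rw [U_complex_eval_eq_prod, ← mul_assoc, ← mul_pow, chebProd]
  have : ∀ m : ℕ, (-a / 2 * 2) ^ n = ∏ _k : Fin n, (-a / 2 * 2) := by simp
  rw [this n, ← Finset.prod_mul_distrib]
  refine Finset.prod_congr rfl fun k _ => ?_
  field_simp
  ring

theorem chebProd_zero (a : ℂ) : chebProd a 0 = 1 := by simp [chebProd]

theorem chebProd_one (a : ℂ) : chebProd a 1 = 1 := by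
  have : angle 1 0 = Real.pi / 2 := by unfold angle; norm_num
  simp only [chebProd, Fin.prod_univ_one, Fin.val_zero, this, Real.cos_pi_div_two]
  simp

theorem chebProd_add_two (a : ℂ) (n : ℕ) :
    chebProd a (n + 2) = chebProd a (n + 1) - a ^ 2 / 4 * chebProd a n := by
  rcases eq_or_ne a 0 with rfl | ha
  · simp [chebProd]
  · rw [chebProd_eq a ha, chebProd_eq a ha, chebProd_eq a ha]
    push_cast
    rw [Polynomial.Chebyshev.U_add_two]
    simp only [Polynomial.eval_sub, Polynomial.eval_mul, Polynomial.eval_ofNat, Polynomial.eval_X]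
    field_simp
    ring

/-- Closed form of the three-term recurrence in terms of the characteristic roots `(1 ± t) / 2`. -/
theorem chebProd_mul (a t : ℂ) (ht : t ^ 2 = 1 - a ^ 2) (n : ℕ) :
    chebProd a n * t = ((1 + t) / 2) ^ (n + 1) - ((1 - t) / 2) ^ (n + 1) := by
  induction n using Nat.twoStepInduction with
  | zero => rw [chebProd_zero]; ring
  | one => rw [chebProd_one]; ring
  | more n h0 h1 =>
    rw [chebProd_add_two, sub_mul, h1, mul_assoc, h0]
    have : a ^ 2 = 1 - t ^ 2 := by rw [ht]; ring
    rw [this]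
    ring

theorem chebProd_of_sq_eq_one (a : ℂ) (ha : a ^ 2 = 1) (n : ℕ) :
    chebProd a n = (n + 1) / 2 ^ n := by
  induction n using Nat.twoStepInduction with
  | zero => rw [chebProd_zero]; simp
  | one => rw [chebProd_one]; norm_num
  | more n h0 h1 =>
    rw [chebProd_add_two, h1, h0, ha]
    push_cast
    field_simp
    ring

/-- If `1 + a c` has no zero for `c ∈ (-1, 1)`, then `1 - a²` is either zero or away from the cut
of the principal square root. -/
theorem sq_eq_one_or_mem_slitPlane {a : ℂ} (h : ∀ c ∈ Set.Ioo (-1 : ℝ) 1, 1 + a * (c : ℂ) ≠ 0) :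
    a ^ 2 = 1 ∨ 1 - a ^ 2 ∈ Complex.slitPlane := by
  by_contra! hc
  obtain ⟨h1, h2⟩ := hc
  rw [Complex.mem_slitPlane_iff] at h2
  push Not at h2
  obtain ⟨hre, him⟩ := h2
  have hre' : 1 ≤ (a ^ 2).re := by simpa using hre
  have him' : (a ^ 2).im = 0 := by simpa using him
  set y := (a ^ 2).re with hy
  have hay : a ^ 2 = (y : ℂ) := Complex.ext rfl (by simpa using him')
  have hy1 : 1 < y := lt_of_le_of_ne hre' fun h => h1 (by rw [hay, ← h]; simp)
  have hs : 1 < √y := Real.lt_sqrt_of_sq_lt (by simpa using hy1)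
  have hi : (√y)⁻¹ < 1 := inv_lt_one_of_one_lt₀ hs
  have hi0 : 0 < (√y)⁻¹ := by positivity
  have hs0 : ((√y : ℝ) : ℂ) ≠ 0 := by exact_mod_cast (by positivity : √y ≠ 0)
  have : a ^ 2 = ((√y : ℝ) : ℂ) ^ 2 := by
    rw [hay, ← Complex.ofReal_pow, Real.sq_sqrt (by linarith)]
  rcases sq_eq_sq_iff_eq_or_eq_neg.1 this with h3 | h3
  · refine h (-(√y)⁻¹) ⟨by linarith, by linarith⟩ ?_
    rw [h3]; push_cast; field_simp; ring
  · refine h ((√y)⁻¹) ⟨by linarith, by linarith⟩ ?_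
    rw [h3]; push_cast; field_simp; ring

theorem sqrt_sq (z : ℂ) : Complex.sqrt z ^ 2 = z := by
  have := Complex.cpow_nat_inv_pow z two_ne_zero
  exact_mod_cast this

theorem re_sqrt (z : ℂ) : (Complex.sqrt z).re = √((‖z‖ + z.re) / 2) :=
  Complex.cpow_inv_two_re z

theorem re_sqrt_nonneg (z : ℂ) : 0 ≤ (Complex.sqrt z).re := by
  rw [re_sqrt]
  exact Real.sqrt_nonneg _

theorem re_sqrt_pos {z : ℂ} (hz : z ∈ Complex.slitPlane) : 0 < (Complex.sqrt z).re := by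
  rw [re_sqrt, Real.sqrt_pos]
  rcases Complex.mem_slitPlane_iff.1 hz with h | h
  · have := norm_nonneg z
    linarith
  · have := neg_lt_of_abs_lt (Complex.abs_re_lt_norm.2 h)
    linarith

theorem norm_one_add_sqrt_div_two_pos (z : ℂ) : 0 < ‖(1 + Complex.sqrt z) / 2‖ := by
  rw [norm_pos_iff]
  refine div_ne_zero (fun h => ?_) two_ne_zero
  have h1 := congrArg Complex.re h
  rw [Complex.add_re, Complex.one_re, Complex.zero_re] at h1
  linarith [re_sqrt_nonneg z]

theorem tendsto_log_div_of_geometric {u : ℕ → ℝ} {m : ℝ} (hm : 0 < m) {v : ℕ → ℝ}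
    (hv : ∀ᶠ n in atTop, v n ≠ 0) (hu : ∀ᶠ n in atTop, u n = m ^ n * v n)
    (hlim : Tendsto (fun n : ℕ => 1 / (n : ℝ) * Real.log (v n)) atTop (𝓝 0)) :
    Tendsto (fun n : ℕ => 1 / (n : ℝ) * Real.log (u n)) atTop (𝓝 (Real.log m)) := by
  have h := hlim.const_add (Real.log m)
  rw [add_zero] at h
  refine h.congr' ?_
  filter_upwards [hv, hu, eventually_ne_atTop 0] with n h1 h2 h3
  have : (n : ℝ) ≠ 0 := by exact_mod_cast h3
  rw [h2, Real.log_mul (pow_ne_zero _ hm.ne') h1, Real.log_pow]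
  field_simp

/-- Growth rate of `chebProd`: the dominant characteristic root is `(1 + √(1 - a²)) / 2`. It
strictly dominates the other one unless `a² = 1`, when the roots coincide and the extra factor
`n + 1` is subexponential. -/
theorem tendsto_log_norm_chebProd {a : ℂ}
    (h : ∀ c ∈ Set.Ioo (-1 : ℝ) 1, 1 + a * (c : ℂ) ≠ 0) :
    Tendsto (fun n : ℕ => 1 / (n : ℝ) * Real.log ‖chebProd a n‖) atTop
      (𝓝 (Real.log ‖(1 + Complex.sqrt (1 - a ^ 2)) / 2‖)) := by
  have hinv : Tendsto (fun n : ℕ => 1 / (n : ℝ)) atTop (𝓝 0) := tendsto_one_div_atTop_nhds_zero_nat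
  rcases sq_eq_one_or_mem_slitPlane h with ha | ha
  · rw [ha, sub_self, Complex.sqrt_zero, add_zero]
    refine tendsto_log_div_of_geometric (v := fun n => (n : ℝ) + 1) (by simp)
      (Eventually.of_forall fun n => by positivity) (Eventually.of_forall fun n => ?_) ?_
    · rw [chebProd_of_sq_eq_one a ha, norm_div, norm_pow, norm_div]
      have : ‖(n : ℂ) + 1‖ = n + 1 := by
        exact_mod_cast Complex.norm_natCast (n + 1)
      rw [this]
      simp
      ring
    · have h1 : Tendsto (fun x : ℝ => Real.log x / x) atTop (𝓝 0) :=
        Real.isLittleO_log_id_atTop.tendsto_div_nhds_zero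
      have h2 : Tendsto (fun n : ℕ => (n : ℝ) + 1) atTop atTop :=
        tendsto_natCast_atTop_atTop.atTop_add tendsto_const_nhds
      have h3 := (h1.comp h2).mul (hinv.const_add 1)
      rw [zero_mul] at h3
      refine h3.congr' ?_
      filter_upwards [eventually_ne_atTop 0] with n hn
      have : (n : ℝ) ≠ 0 := by exact_mod_cast hn
      simp only [Function.comp_apply]
      field_simp
  · set t := Complex.sqrt (1 - a ^ 2) with ht
    have hre : 0 < t.re := re_sqrt_pos ha
    have ht0 : t ≠ 0 := fun h0 => by simp [h0] at hre
    set μ := (1 + t) / 2 with hμ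
    set ν := (1 - t) / 2 with hν
    have hμ0 : 0 < ‖μ‖ := norm_one_add_sqrt_div_two_pos _
    have hμ0' : μ ≠ 0 := norm_pos_iff.1 hμ0
    have hlt : ‖ν / μ‖ < 1 := by
      rw [norm_div, div_lt_one hμ0, hμ, hν, norm_div, norm_div]
      refine div_lt_div_of_pos_right ?_ (by simp)
      rw [← sq_lt_sq₀ (norm_nonneg _) (norm_nonneg _), Complex.sq_norm, Complex.sq_norm,
        Complex.normSq_apply, Complex.normSq_apply]
      simp only [Complex.sub_re, Complex.add_re, Complex.one_re, Complex.sub_im, Complex.add_im,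
        Complex.one_im]
      nlinarith
    have hw : Tendsto (fun n : ℕ => ‖μ / t * (1 - (ν / μ) ^ (n + 1))‖) atTop (𝓝 ‖μ / t‖) := by
      have h1 := ((tendsto_pow_atTop_nhds_zero_of_norm_lt_one hlt).comp
        (tendsto_add_atTop_nat 1)).const_sub 1
      simpa using (h1.const_mul (μ / t)).norm
    have hne : ‖μ / t‖ ≠ 0 := norm_ne_zero_iff.2 (div_ne_zero hμ0' ht0)
    refine tendsto_log_div_of_geometric hμ0 (hw.eventually_ne hne)
      (Eventually.of_forall fun n => ?_) ?_
    · rw [← norm_pow, ← norm_mul]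
      congr 1
      have key := chebProd_mul a t (sqrt_sq _) n
      rw [← hμ, ← hν] at key
      clear_value μ ν t
      rw [← mul_left_inj' ht0, key, div_pow]
      field_simp
      ring
    · simpa using hinv.mul (hw.log hne)

/-! ### The domain as the set of nonnegative symbols -/

theorem mem_dom1_iff (φ : ℝ) (l : ℝ × ℝ) : l ∈ dom1 φ ↔
    p φ l - 2 * s φ l ≤ 4 * s φ l ∧ 0 ≤ p φ l - 2 * s φ l ∧
      q φ l ^ 2 ≤ 4 * s φ l * (p φ l - 2 * s φ l) := by
  have h : 0 < 2 * (1 + φ ^ 2) := by positivity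
  rw [dom1, Set.mem_ofPred_eq, div_le_iff₀ h, le_div_iff₀ h]
  simp only [p, q, s]
  refine and_congr ?_ (and_congr ?_ ?_) <;> constructor <;> intro h <;> linarith

theorem mem_dom2_iff {φ : ℝ} (hφ : |φ| < 1) (l : ℝ × ℝ) : l ∈ dom2 φ ↔
    4 * s φ l < p φ l - 2 * s φ l ∧ -(p φ l - 2 * s φ l) ≤ 4 * s φ l ∧
      0 ≤ symbol φ l (-1) ∧ 0 ≤ symbol φ l 1 := by
  obtain ⟨h1, h2⟩ := abs_lt.1 hφ
  have h3 : 0 < 2 * (1 - φ) ^ 2 := by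
    have : 0 < 1 - φ := by linarith
    positivity
  have h4 : 0 < 2 * (1 + φ) ^ 2 := by
    have : 0 < 1 + φ := by linarith
    positivity
  rw [dom2, Set.mem_ofPred_eq, sub_le_comm, le_div_iff₀ h3, le_sub_iff_add_le, le_div_iff₀ h4]
  simp only [symbol, p, s]
  refine and_congr ?_ (and_congr ?_ (and_congr ?_ ?_)) <;> constructor <;> intro h <;> linarith

theorem quadratic_nonneg_of_discrim {u q s : ℝ} (h1 : u ≤ 4 * s) (h2 : 0 ≤ u)
    (h3 : q ^ 2 ≤ 4 * s * u) (c : ℝ) : 0 ≤ u + 2 * q * c + 4 * s * c ^ 2 := by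
  rcases (by linarith : 0 ≤ 4 * s).eq_or_lt with h | h
  · have hu : u = 0 := by linarith
    have hq : q = 0 := by
      rw [hu, mul_zero] at h3
      exact pow_eq_zero_iff two_ne_zero |>.1 (le_antisymm h3 (sq_nonneg q))
    rw [← h, hu, hq]
    simp
  · refine nonneg_of_mul_nonneg_right ?_ h
    nlinarith [sq_nonneg (4 * s * c + q)]

/-- Under `4 s < u` the vertex of the quadratic is irrelevant: nonnegativity on `[-1, 1]` is
decided at the endpoints. -/
theorem quadratic_nonneg_of_endpoints {u q s : ℝ} (h1 : 4 * s < u)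
    (h3 : 0 ≤ u - 2 * q + 4 * s) (h4 : 0 ≤ u + 2 * q + 4 * s) {c : ℝ}
    (hc : c ∈ Set.Icc (-1) 1) : 0 ≤ u + 2 * q * c + 4 * s * c ^ 2 := by
  obtain ⟨hc1, hc2⟩ := hc
  rcases le_total s 0 with hs | hs
  · nlinarith [mul_nonneg (by linarith : 0 ≤ 1 + c) h4, mul_nonneg (by linarith : 0 ≤ 1 - c) h3,
      mul_nonneg (neg_nonneg.2 hs) (by nlinarith : 0 ≤ 1 - c ^ 2)]
  · -- for `c ≥ 0` the quadratic is at least `(1 - c) (u - 4 s c)`, and symmetrically for `c ≤ 0`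
    rcases le_total 0 c with h0 | h0
    · have : 0 ≤ (1 - c) * (u - 4 * s * c) := by
        refine mul_nonneg (by linarith) ?_
        nlinarith [mul_nonneg hs (by linarith : 0 ≤ 1 - c)]
      nlinarith [mul_nonneg h0 h4]
    · have : 0 ≤ (1 + c) * (u + 4 * s * c) := by
        refine mul_nonneg (by linarith) ?_
        nlinarith [mul_nonneg hs (by linarith : 0 ≤ 1 + c)]
      nlinarith [mul_nonneg (neg_nonneg.2 h0) h3]

theorem discrim_le_of_quadratic_nonneg {u q s : ℝ}
    (h : ∀ c ∈ Set.Icc (-1 : ℝ) 1, 0 ≤ u + 2 * q * c + 4 * s * c ^ 2) (hus : u ≤ 4 * s) :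
    q ^ 2 ≤ 4 * s * u := by
  have h0 := h 0 (by simp)
  have h1 := h 1 (by simp)
  have h2 := h (-1) (by simp)
  norm_num at h0 h1 h2
  rcases (by linarith : 0 ≤ 4 * s).eq_or_lt with hs | hs
  · have hq : q = 0 := by linarith
    rw [← hs, hq]
    simp
  · -- evaluate at the vertex, which lies in `[-1, 1]`
    have hv := h (-q / (4 * s)) ⟨by rw [le_div_iff₀ hs]; linarith, by
      rw [div_le_one hs]; linarith⟩
    have : 4 * s * (u + 2 * q * (-q / (4 * s)) + 4 * s * (-q / (4 * s)) ^ 2) =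
        4 * s * u - q ^ 2 := by
      have hs' : s ≠ 0 := by
        rintro rfl
        simp at hs
      field_simp
      ring
    linarith [mul_nonneg hs.le hv]

theorem symbol_nonneg_of_mem_dom {φ : ℝ} (hφ : |φ| < 1) {l : ℝ × ℝ} (hl : l ∈ dom φ) {c : ℝ}
    (hc : c ∈ Set.Icc (-1) 1) : 0 ≤ symbol φ l c := by
  rw [symbol_eq]
  rcases hl with hl | hl
  · obtain ⟨h1, h2, h3⟩ := (mem_dom1_iff φ l).1 hl
    exact quadratic_nonneg_of_discrim h1 h2 h3 c
  · obtain ⟨h1, -, h3, h4⟩ := (mem_dom2_iff hφ l).1 hl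
    rw [symbol_eq] at h3 h4
    exact quadratic_nonneg_of_endpoints h1 (by linarith) (by linarith) hc

theorem mem_dom_of_symbol_nonneg {φ : ℝ} (hφ : |φ| < 1) {l : ℝ × ℝ}
    (h : ∀ c ∈ Set.Icc (-1 : ℝ) 1, 0 ≤ symbol φ l c) : l ∈ dom φ := by
  have h' := h
  simp only [symbol_eq] at h'
  have h0 := h' 0 (by simp)
  have h1 := h' 1 (by simp)
  have h2 := h' (-1) (by simp)
  norm_num at h0 h1 h2
  rcases lt_or_ge (4 * s φ l) (p φ l - 2 * s φ l) with hs | hs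
  · exact Or.inr <| (mem_dom2_iff hφ l).2
      ⟨hs, by linarith, h (-1) (by simp), h 1 (by simp)⟩
  · exact Or.inl <| (mem_dom1_iff φ l).2
      ⟨hs, by linarith, discrim_le_of_quadratic_nonneg h' hs⟩

/-- Outside the domain the symbol is negative somewhere in the open interval. -/
theorem exists_symbol_neg {φ : ℝ} (hφ : |φ| < 1) {l : ℝ × ℝ} (hl : l ∉ dom φ) :
    ∃ c ∈ Set.Ioo (-1 : ℝ) 1, symbol φ l c < 0 := by
  by_contra! h
  refine hl (mem_dom_of_symbol_nonneg hφ fun c hc => ?_)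
  have hcl : closure (Set.Ioo (-1 : ℝ) 1) ⊆ {c | 0 ≤ symbol φ l c} :=
    closure_minimal h (isClosed_le continuous_const (continuous_symbol φ l))
  rw [closure_Ioo (by norm_num)] at hcl
  exact hcl hc

/-- The nodes `cos θ_k` become dense in `(-1, 1)`: take `k = ⌊x n⌋` where `c = cos (x π)`. -/
theorem exists_tendsto_cos_angle {c : ℝ} (hc : c ∈ Set.Ioo (-1) 1) :
    ∃ k : ℕ → ℕ, (∀ᶠ n in atTop, k n < n) ∧
      Tendsto (fun n => Real.cos (angle n (k n))) atTop (𝓝 c) := by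
  set x := Real.arccos c / Real.pi with hx
  have hx0 : 0 ≤ x := div_nonneg (Real.arccos_nonneg c) Real.pi_pos.le
  have hx1 : x < 1 := by
    rw [hx, div_lt_one Real.pi_pos, ← Real.arccos_neg_one]
    exact Real.arccos_lt_arccos le_rfl hc.1 hc.2.le
  refine ⟨fun n => ⌊x * n⌋₊, ?_, ?_⟩
  · filter_upwards [eventually_gt_atTop 0] with n hn
    rw [Nat.floor_lt (by positivity)]
    have : (0 : ℝ) < n := by exact_mod_cast hn
    nlinarith
  · have h1 : Tendsto (fun n : ℕ => (⌊x * n⌋₊ : ℝ) / n) atTop (𝓝 x) :=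
      (tendsto_nat_floor_mul_div_atTop hx0).comp tendsto_natCast_atTop_atTop
    have h2 : Tendsto (fun n : ℕ => 1 / (n : ℝ)) atTop (𝓝 0) := tendsto_one_div_atTop_nhds_zero_nat
    have h3 : Tendsto (fun n : ℕ => ((⌊x * n⌋₊ : ℝ) / n + 1 / n) * Real.pi / (1 + 1 / (n : ℝ)))
        atTop (𝓝 ((x + 0) * Real.pi / (1 + 0))) :=
      ((h1.add h2).mul_const _).div (h2.const_add 1) (by norm_num)
    have h4 : (x + 0) * Real.pi / (1 + 0) = Real.arccos c := by
      rw [hx]; field_simp; ring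
    rw [h4] at h3
    have h5 := (Real.continuous_cos.tendsto _).comp h3
    rw [Real.cos_arccos hc.1.le hc.2.le] at h5
    refine h5.congr' ?_
    filter_upwards [eventually_ne_atTop 0] with n hn
    have : (n : ℝ) ≠ 0 := by exact_mod_cast hn
    simp only [Function.comp_apply, angle]
    congr 1
    field_simp

/-- The curve of parameters whose symbol has a double zero at `c`. -/
noncomputable def doubleZeroCurve (φ c : ℝ) : ℝ × ℝ :=
  ((1 + φ ^ 2 + 4 * φ * c) / (2 * (1 + φ ^ 2 + 2 * φ * c) ^ 2), -φ / (1 + φ ^ 2 + 2 * φ * c) ^ 2)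

theorem symbol_doubleZeroCurve {φ : ℝ} (hφ : |φ| < 1) {c : ℝ} (hc : c ∈ Set.Icc (-1) 1) :
    symbol φ (doubleZeroCurve φ c) c = 0 := by
  have h := (spectralDensity_pos hφ hc).ne'
  simp only [symbol, doubleZeroCurve]
  field_simp
  ring

/-- Shifting `k` by one identifies the points defining `dom0` with the curve over the nodes. -/
theorem mem_dom0_iff (φ : ℝ) (l : ℝ × ℝ) :
    l ∈ dom0 φ ↔ ∃ n k : ℕ, k < n ∧ l = doubleZeroCurve φ (Real.cos (angle n k)) := by
  constructor
  · rintro ⟨n, k, hk1, hkn, h1, h2⟩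
    obtain ⟨k, rfl⟩ := Nat.exists_eq_add_of_le' hk1
    refine ⟨n, k, hkn, Prod.ext ?_ ?_⟩
    · rw [h1]; simp [doubleZeroCurve, angle]
    · rw [h2]; simp [doubleZeroCurve, angle]
  · rintro ⟨n, k, hkn, rfl⟩
    exact ⟨n, k + 1, by omega, hkn, by simp [doubleZeroCurve, angle],
      by simp [doubleZeroCurve, angle]⟩

theorem doubleZeroCurve_mem_closure {φ : ℝ} (hφ : |φ| < 1) {c : ℝ} (hc : c ∈ Set.Ioo (-1) 1) :
    doubleZeroCurve φ c ∈ closure (dom0 φ) := by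
  obtain ⟨k, hk, hlim⟩ := exists_tendsto_cos_angle hc
  have h := (spectralDensity_pos hφ (Set.Ioo_subset_Icc_self hc)).ne'
  have hcont : ContinuousAt (doubleZeroCurve φ) c := by
    unfold doubleZeroCurve
    refine ContinuousAt.prodMk (ContinuousAt.div (by fun_prop) (by fun_prop) ?_)
      (ContinuousAt.div (by fun_prop) (by fun_prop) ?_) <;> positivity
  refine mem_closure_of_tendsto (hcont.tendsto.comp hlim) ?_
  filter_upwards [hk] with n hn
  exact (mem_dom0_iff φ _).2 ⟨n, k n, hn, rfl⟩

/-- A zero of a nonnegative symbol in the open interval is a double zero, which puts the parameter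
on the curve. -/
theorem eq_doubleZeroCurve {φ : ℝ} (hφ : |φ| < 1) {l : ℝ × ℝ} (hl : l ∈ dom φ) {c : ℝ}
    (hc : c ∈ Set.Ioo (-1) 1) (h0 : symbol φ l c = 0) : l = doubleZeroCurve φ c := by
  have hw := (spectralDensity_pos hφ (Set.Ioo_subset_Icc_self hc)).ne'
  have hmin : IsLocalMin (symbol φ l) c := by
    filter_upwards [Ioo_mem_nhds hc.1 hc.2] with x hx
    rw [h0]
    exact symbol_nonneg_of_mem_dom hφ hl (Set.Ioo_subset_Icc_self hx)
  have hder : HasDerivAt (symbol φ l)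
      (-(2 * l.2 * (1 + φ ^ 2 + 2 * φ * c) + 2 * (l.1 + l.2 * c) * (2 * φ))) c := by
    have e1 : HasDerivAt (fun x : ℝ => 2 * (l.1 + l.2 * x)) (2 * l.2) c := by
      simpa using (((hasDerivAt_id c).const_mul l.2).const_add l.1).const_mul 2
    have e2 : HasDerivAt (fun x : ℝ => 1 + φ ^ 2 + 2 * φ * x) (2 * φ) c := by
      simpa using ((hasDerivAt_id c).const_mul (2 * φ)).const_add (1 + φ ^ 2)
    exact (e1.mul e2).const_sub 1
  have hd := hmin.hasDerivAt_eq_zero hder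
  set w := 1 + φ ^ 2 + 2 * φ * c with hwdef
  have h1 : 2 * (l.1 + l.2 * c) * w = 1 := by
    simp only [symbol, ← hwdef] at h0
    linarith
  have h2 : l.2 = -φ / w ^ 2 := by
    rw [eq_div_iff (by positivity)]
    linear_combination (-w / 2) * hd - φ * h1
  refine Prod.ext ?_ h2
  have h3 : l.1 = 1 / (2 * w) - l.2 * c := by
    field_simp
    linear_combination h1
  have h4 : 1 + φ ^ 2 + 4 * φ * c = w + 2 * φ * c := by rw [hwdef]; ring
  simp only [doubleZeroCurve, ← hwdef]
  rw [h3, h2, h4]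
  field_simp
  ring

theorem symbol_pos {φ : ℝ} (hφ : |φ| < 1) {l : ℝ × ℝ} (hl : l ∈ dom φ \ closure (dom0 φ)) {c : ℝ}
    (hc : c ∈ Set.Ioo (-1) 1) : 0 < symbol φ l c := by
  refine lt_of_le_of_ne (symbol_nonneg_of_mem_dom hφ hl.1 (Set.Ioo_subset_Icc_self hc)) ?_
  intro h0
  apply hl.2
  rw [eq_doubleZeroCurve hφ hl.1 hc h0.symm]
  exact doubleZeroCurve_mem_closure hφ hc

theorem cos_angle_mem_Ioo {n k : ℕ} (h : k < n) : Real.cos (angle n k) ∈ Set.Ioo (-1 : ℝ) 1 := by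
  have h1 := angle_pos n k
  have h2 := angle_lt_pi h
  constructor
  · rw [← Real.cos_pi]
    exact Real.cos_lt_cos_of_nonneg_of_le_pi h1.le le_rfl h2
  · rw [← Real.cos_zero]
    exact Real.cos_lt_cos_of_nonneg_of_le_pi le_rfl h2.le h1

/-! ### The limit -/

theorem sqrt_ofReal {x : ℝ} (hx : 0 ≤ x) : Complex.sqrt (x : ℂ) = ((√x : ℝ) : ℂ) := by
  open ComplexOrder in
  have h : (0 : ℂ) ≤ (x : ℂ) := by exact_mod_cast hx
  rw [Complex.sqrt_of_nonneg h, Complex.ofReal_re]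

/-- The principal square root commutes with conjugation off the open negative axis, where it is
discontinuous. -/
theorem sqrt_conj {z : ℂ} (hz : z = 0 ∨ z ∈ Complex.slitPlane) :
    Complex.sqrt ((starRingEnd ℂ) z) = (starRingEnd ℂ) (Complex.sqrt z) := by
  rcases hz with rfl | hz
  · simp
  · have h := Complex.conj_cpow z 2⁻¹ (Complex.mem_slitPlane_iff_arg.1 hz).1
    rwa [map_inv₀, Complex.conj_ofNat] at h

/-- Factorisation of the symbol: `-1/A` and `-1/B` are its roots. -/
theorem symbol_eq_mul {φ : ℝ} {l : ℝ × ℝ} (hu : p φ l - 2 * s φ l ≠ 0) (c : ℝ) :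
    (symbol φ l c : ℂ) =
      ((p φ l - 2 * s φ l : ℝ) : ℂ) * ((1 + A φ l * (c : ℂ)) * (1 + B φ l * (c : ℂ))) := by
  have hR : rootDisc φ l ^ 2 =
      ((q φ l ^ 2 - 4 * s φ l * (p φ l - 2 * s φ l) : ℝ) : ℂ) := sqrt_sq _
  have hu' : ((p φ l - 2 * s φ l : ℝ) : ℂ) ≠ 0 := by exact_mod_cast hu
  rw [symbol_eq, A, B]
  generalize rootDisc φ l = R at *
  generalize p φ l - 2 * s φ l = u at *
  push_cast at *
  field_simp
  linear_combination (c : ℂ) ^ 2 * hR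

section Interior

variable {φ : ℝ} {l : ℝ × ℝ}

theorem p_sub_two_mul_s_pos (h : ∀ c ∈ Set.Ioo (-1 : ℝ) 1, 0 < symbol φ l c) :
    0 < p φ l - 2 * s φ l := by
  simpa [symbol_eq] using h 0 (by simp)

theorem linear_factors_ne_zero (h : ∀ c ∈ Set.Ioo (-1 : ℝ) 1, 0 < symbol φ l c) {c : ℝ}
    (hc : c ∈ Set.Ioo (-1) 1) : 1 + A φ l * (c : ℂ) ≠ 0 ∧ 1 + B φ l * (c : ℂ) ≠ 0 := by
  have h1 : (symbol φ l c : ℂ) ≠ 0 := by exact_mod_cast (h c hc).ne'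
  rw [symbol_eq_mul (p_sub_two_mul_s_pos h).ne'] at h1
  exact mul_ne_zero_iff.1 (right_ne_zero_of_mul h1)

theorem sqrt_one_sub_sq_ofReal {a : ℝ} (h : (a : ℂ) ^ 2 = 1 ∨ 1 - (a : ℂ) ^ 2 ∈ Complex.slitPlane) :
    Complex.sqrt (1 - (a : ℂ) ^ 2) = ((√(1 - a ^ 2) : ℝ) : ℂ) := by
  have h1 : 1 - (a : ℂ) ^ 2 = ((1 - a ^ 2 : ℝ) : ℂ) := by push_cast; rfl
  have h0 : 0 ≤ 1 - a ^ 2 := by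
    rcases h with h | h
    · have : a ^ 2 = 1 := by exact_mod_cast h
      linarith
    · rw [h1, Complex.ofReal_mem_slitPlane] at h
      exact h.le
  rw [h1, sqrt_ofReal h0]

/-- The argument of the logarithm is a positive real: `A` and `B` are either real and in
`[-1, 1]`, or complex conjugates of each other. -/
theorem exists_logArg_eq_ofReal (h : ∀ c ∈ Set.Ioo (-1 : ℝ) 1, 0 < symbol φ l c) :
    ∃ x : ℝ, 0 < x ∧ logArg φ l = (x : ℂ) := by
  have hu := p_sub_two_mul_s_pos h
  have hA := sq_eq_one_or_mem_slitPlane fun c hc => (linear_factors_ne_zero h hc).1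
  have hB := sq_eq_one_or_mem_slitPlane fun c hc => (linear_factors_ne_zero h hc).2
  rcases le_or_gt 0 (q φ l ^ 2 - 4 * s φ l * (p φ l - 2 * s φ l)) with hd | hd
  · have hR : rootDisc φ l = ((√(q φ l ^ 2 - 4 * s φ l * (p φ l - 2 * s φ l)) : ℝ) : ℂ) :=
      sqrt_ofReal hd
    obtain ⟨a, ha⟩ : ∃ a : ℝ, A φ l = (a : ℂ) := ⟨_, by rw [A, hR]; norm_cast⟩
    obtain ⟨b, hb⟩ : ∃ b : ℝ, B φ l = (b : ℂ) := ⟨_, by rw [B, hR]; norm_cast⟩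
    rw [ha] at hA
    rw [hb] at hB
    refine ⟨(p φ l - 2 * s φ l) * (1 + √(1 - a ^ 2)) * (1 + √(1 - b ^ 2)) / 4,
      by positivity, ?_⟩
    rw [logArg, ha, hb, sqrt_one_sub_sq_ofReal hA, sqrt_one_sub_sq_ofReal hB]
    push_cast
    ring
  · have hR : (starRingEnd ℂ) (rootDisc φ l) = -rootDisc φ l := by
      have h1 : rootDisc φ l =
          Complex.I * ((√(-(q φ l ^ 2 - 4 * s φ l * (p φ l - 2 * s φ l))) : ℝ) : ℂ) := by
        open ComplexOrder in
        have h2 : (0 : ℂ) ≤ ((-(q φ l ^ 2 - 4 * s φ l * (p φ l - 2 * s φ l)) : ℝ) : ℂ) := by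
          exact_mod_cast (neg_pos.2 hd).le
        rw [← sqrt_ofReal (neg_pos.2 hd).le, ← Complex.sqrt_neg_of_nonneg h2, rootDisc]
        congr 1
        push_cast
        ring
      rw [h1]
      simp
    have hconj : B φ l = (starRingEnd ℂ) (A φ l) := by
      rw [A, B, map_div₀, map_sub, hR, Complex.conj_ofReal, Complex.conj_ofReal, sub_neg_eq_add]
    have hsq : Complex.sqrt (1 - B φ l ^ 2) =
        (starRingEnd ℂ) (Complex.sqrt (1 - A φ l ^ 2)) := by
      rw [← sqrt_conj (hA.imp_left fun h => by rw [h, sub_self]), hconj]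
      simp
    refine ⟨(p φ l - 2 * s φ l) * Complex.normSq (1 + Complex.sqrt (1 - A φ l ^ 2)) / 4, ?_, ?_⟩
    · have : 0 < Complex.normSq (1 + Complex.sqrt (1 - A φ l ^ 2)) := by
        refine Complex.normSq_pos.2 fun h0 => ?_
        have := norm_one_add_sqrt_div_two_pos (1 - A φ l ^ 2)
        rw [h0] at this
        simp at this
      positivity
    · rw [logArg, hsq]
      push_cast
      rw [Complex.normSq_eq_conj_mul_self, map_add, map_one]
      ring

/-- The normalised logarithm of the product of the symbol over the nodes, from the growth rates of
the two linear factors. -/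
theorem tendsto_log_prod_symbol (h : ∀ c ∈ Set.Ioo (-1 : ℝ) 1, 0 < symbol φ l c) :
    Tendsto (fun n : ℕ => -(1 / (2 * (n : ℝ))) *
        Real.log (∏ k : Fin n, symbol φ l (Real.cos (angle n k)))) atTop
      (𝓝 (-(1 / 2) * Real.log (logArg φ l).re)) := by
  have hu := p_sub_two_mul_s_pos h
  have hA := tendsto_log_norm_chebProd fun c hc => (linear_factors_ne_zero h hc).1
  have hB := tendsto_log_norm_chebProd fun c hc => (linear_factors_ne_zero h hc).2
  have hlim : Real.log (logArg φ l).re = Real.log (p φ l - 2 * s φ l) +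
      Real.log ‖(1 + Complex.sqrt (1 - A φ l ^ 2)) / 2‖ +
      Real.log ‖(1 + Complex.sqrt (1 - B φ l ^ 2)) / 2‖ := by
    obtain ⟨x, hx, hxe⟩ := exists_logArg_eq_ofReal h
    have hA0 := norm_one_add_sqrt_div_two_pos (1 - A φ l ^ 2)
    have hB0 := norm_one_add_sqrt_div_two_pos (1 - B φ l ^ 2)
    rw [← Real.log_mul hu.ne' hA0.ne', ← Real.log_mul (by positivity) hB0.ne', hxe,
      Complex.ofReal_re]
    congr 1
    rw [← abs_of_pos hx, ← Real.norm_eq_abs, ← Complex.norm_real, ← hxe, logArg]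
    simp only [norm_mul, norm_div, Complex.norm_real, Real.norm_eq_abs, abs_of_pos hu]
    norm_num
    ring
  rw [hlim]
  refine (((hA.const_add (Real.log (p φ l - 2 * s φ l))).add hB).const_mul (-(1 / 2))).congr' ?_
  filter_upwards [eventually_ne_atTop 0] with n hn
  have hn' : (n : ℝ) ≠ 0 := by exact_mod_cast hn
  have hne : ‖chebProd (A φ l) n‖ ≠ 0 ∧ ‖chebProd (B φ l) n‖ ≠ 0 :=
    ⟨norm_ne_zero_iff.2 <| Finset.prod_ne_zero_iff.2 fun k _ =>
      (linear_factors_ne_zero h (cos_angle_mem_Ioo k.2)).1,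
    norm_ne_zero_iff.2 <| Finset.prod_ne_zero_iff.2 fun k _ =>
      (linear_factors_ne_zero h (cos_angle_mem_Ioo k.2)).2⟩
  have hprod : ∏ k : Fin n, symbol φ l (Real.cos (angle n k)) =
      (p φ l - 2 * s φ l) ^ n * ‖chebProd (A φ l) n‖ * ‖chebProd (B φ l) n‖ := by
    have hpos : 0 < ∏ k : Fin n, symbol φ l (Real.cos (angle n k)) :=
      Finset.prod_pos fun (k : Fin n) _ => h _ (cos_angle_mem_Ioo k.2)
    rw [← abs_of_pos hpos, ← Real.norm_eq_abs, ← Complex.norm_real, Complex.ofReal_prod,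
      Finset.prod_congr rfl fun (k : Fin n) _ => symbol_eq_mul hu.ne' (Real.cos (angle n k)),
      Finset.prod_mul_distrib, Finset.prod_mul_distrib, Finset.prod_const, Finset.card_univ,
      Fintype.card_fin, norm_mul, norm_mul, norm_pow, Complex.norm_real, Real.norm_eq_abs,
      abs_of_pos hu, ← mul_assoc]
    rfl
  rw [hprod, Real.log_mul (mul_ne_zero (by positivity) hne.1) hne.2,
    Real.log_mul (by positivity) hne.1, Real.log_pow]
  field_simp

end Interior

end MA1

theorem proposition4p1 {Ω : Type*} [MeasurableSpace Ω] (P : Measure Ω) [IsProbabilityMeasure P]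
    (φ : ℝ) (hφ : |φ| < 1) (ε : ℕ → Ω → ℝ)
    (hlaw : ∀ n, HasLaw (ε n) (gaussianReal 0 1) P) (hindep : iIndepFun ε P) (l : ℝ × ℝ) :
    -- inside the domain, off the closure of the exceptional set: the formula is meaningful,
    -- and it is the limit of the normalized log-determinants
    (l ∈ MA1.dom φ \ closure (MA1.dom0 φ) →
      0 < (MA1.logArg φ l).re ∧ (MA1.logArg φ l).im = 0 ∧
      (∀ n, 2 ≤ n → (MA1.D φ l n).PosDef) ∧
      Tendsto (fun n : ℕ => -(1 / (2 * (n : ℝ))) * Real.log (MA1.D φ l n).det) atTop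
        (𝓝 (-(1 / 2) * Real.log (MA1.logArg φ l).re))) ∧
    -- convergence of the normalized cumulant generating function
    ((l ∈ MA1.dom φ \ closure (MA1.dom0 φ) ∨ l ∉ MA1.dom φ) →
      Tendsto (fun n : ℕ => MA1.L P φ ε n l) atTop (𝓝 (MA1.calL φ l))) ∧
    -- on the exceptional set itself, the value `+∞` is attained infinitely often
    (l ∈ MA1.dom0 φ → ∃ᶠ n : ℕ in atTop, MA1.L P φ ε n l = ⊤) := by
  refine ⟨fun hl => ?_, ?_, fun hl => ?_⟩
  · have hpos : ∀ c ∈ Set.Ioo (-1 : ℝ) 1, 0 < MA1.symbol φ l c := fun c hc =>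
      MA1.symbol_pos hφ hl hc
    obtain ⟨x, hx, hxe⟩ := MA1.exists_logArg_eq_ofReal hpos
    refine ⟨by rwa [hxe], by rw [hxe, Complex.ofReal_im],
      fun n hn => MA1.posDef_D φ l hn fun k hk => hpos _ (MA1.cos_angle_mem_Ioo hk), ?_⟩
    refine (MA1.tendsto_log_prod_symbol hpos).congr' ?_
    filter_upwards [eventually_ge_atTop 2] with n hn
    rw [MA1.det_D φ l hn]
  · rintro (hl | hl)
    · have hpos : ∀ c ∈ Set.Ioo (-1 : ℝ) 1, 0 < MA1.symbol φ l c := fun c hc =>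
        MA1.symbol_pos hφ hl hc
      rw [MA1.calL, if_pos hl]
      simp only [MA1.L_of_symbol_pos hφ hlaw hindep fun k hk => hpos _ (MA1.cos_angle_mem_Ioo hk)]
      exact (continuous_coe_real_ereal.tendsto _).comp (MA1.tendsto_log_prod_symbol hpos)
    · rw [MA1.calL, if_neg fun h => hl h.1]
      obtain ⟨c, hc, hneg⟩ := MA1.exists_symbol_neg hφ hl
      obtain ⟨k, hk, hlim⟩ := MA1.exists_tendsto_cos_angle hc
      have hev := (((MA1.continuous_symbol φ l).tendsto c).comp hlim).eventually_lt_const hneg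
      refine tendsto_const_nhds.congr' ?_
      filter_upwards [hk, hev] with n h1 h2
      exact (MA1.L_eq_top hφ hlaw hindep h1 h2.le).symm
  · obtain ⟨n, k, hkn, rfl⟩ := (MA1.mem_dom0_iff φ l).1 hl
    rw [frequently_atTop]
    -- refine the grid: `(k + 1) / (n + 1) = (k + 1) (N + 1) / ((n + 1) (N + 1))`
    refine fun N => ⟨n * N + n + N, by omega, ?_⟩
    have hang : MA1.angle (n * N + n + N) (k * N + k + N) = MA1.angle n k := by
      have h1 : (N : ℝ) + 1 ≠ 0 := by positivity
      have h2 : (n : ℝ) * N + n + N + 1 = (n + 1) * (N + 1) := by ring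
      have h3 : (k : ℝ) * N + k + N + 1 = (k + 1) * (N + 1) := by ring
      unfold MA1.angle
      push_cast
      rw [h2, h3]
      field_simp
    refine MA1.L_eq_top hφ hlaw hindep (k := k * N + k + N) ?_ ?_
    · have := Nat.mul_le_mul_right N hkn.le
      omega
    · rw [hang, MA1.symbol_doubleZeroCurve hφ (Set.Ioo_subset_Icc_self (MA1.cos_angle_mem_Ioo hkn))]
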